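/- Inner products are antilinear in the first argument. Let $(q_k)_{k\ge1}$ be real numbers and $(b_k)_{k\ge1}$ positive numbers. Let $J_0$ be the operator in $\ell_2(\mathbb N)$, $\mathbb N=\{1,2,\dots\}$, defined on the finitely supported sequences by $(J_0\phi)_1=q_1\phi_1+b_1\phi_2$ and $(J_0\phi)_k=b_{k-1}\phi_{k-1}+q_k\phi_k+b_k\phi_{k+1}$ for $k\ge2$, and let $J=\overline{J_0}$ be the associated Jacobi operator. Let $\delta_1$ be the first vector of the canonical basis, $\mathcal I$ the componentwise complex conjugation on $\ell_2(\mathbb N)$, and $\pi(z)=(\pi_k(z))_{k\ge1}$ the polynomials of the first kind: $\pi_1=1$, $z\pi_1=q_1\pi_1+b_1\pi_2$, $z\pi_k=b_{k-1}\pi_{k-1}+q_k\pi_k+b_k\pi_{k+1}$ for $k\ge2$. Definitions. A closed operator $A$ in a Hilbert space $\mathcal H$ is regular if for every $z\in\mathbb C$ there is $C>0$ with $\|(A-zI)\phi\|\ge C\|\phi\|$ for all $\phi\in\operatorname{dom}A$. For $\mu\in\mathcal H$ let $S_\mu$ be the set of those $z\in\mathbb C$ for which $\mathcal H=\operatorname{ran}(A-zI)\dotplus\operatorname{span}\{\mu\}$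 (algebraic direct sum) fails; $\mu$ is a gauge of $A$ if $S_\mu$ is at most countable, and an entire gauge if moreover $S_\mu=\emptyset$. A regular, densely defined symmetric operator $A$ with $\dim\ker(A^*- iI)=\dim\ker(A^*+iI)=1$ is entire (in Krein's sense) if it has an entire gauge. A conjugation is an antilinear involution $\mathcal C$ of $\mathcal H$ with $\langle\mathcal C\phi,\mathcal C\psi\rangle=\langle\psi,\phi\rangle$; it commutes with $A$ if $\mathcal C\operatorname{dom}A\subset\operatorname{dom}A$ and $A\mathcal C\phi=\mathcal CA\phi$ for $\phi\in\operatorname{dom}A$. Proposition. If $J$ is not selfadjoint, then $J$ is an entire operator (in particular it is regular and has deficiency indices $(1,1)$), and $\delta_1$ is an entire gauge of $J$. Moreover, $\mathcal I$ is a conjugation commuting with $J$; for every $z\in\mathbb C$ the sequence $\pi(z)$ belongs to $\ell_2(\mathbb N)$; and the function $\xi=\pi:\mathbb C\to\ell_2(\mathbb N)$ is entire and zero-free and satisfies $\xi(z)\in\ker(J^*-zI)$, $\mathcal I\xi(z)=\xi(\overline z)$ and $\langle\xi(\overline z),\delta_1\rangle=1$ for all $z\in\mathbb C$. -/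

import Mathlib

open scoped ComplexConjugate InnerProductSpace

/-- The Hilbert space `ℓ²(ℕ)` of square summable complex sequences. The index `k : ℕ` stands for
the positive integer `k + 1`. -/
abbrev L2Seq : Type := lp (fun _ : ℕ => ℂ) 2

noncomputable section

/-! ### Operators in a Hilbert space -/

section Operators

variable {H : Type*} [NormedAddCommGroup H] [InnerProductSpace ℂ H]

/-- A (densely defined) symmetric operator: `⟪A φ, ψ⟫ = ⟪φ, A ψ⟫` for `φ, ψ ∈ dom A`. -/
structure IsSymmetricOperator (A : H →ₗ.[ℂ] H) : Prop where
  dense_domain : Dense (A.domain : Set H)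
  symmetric : A.IsFormalAdjoint A

/-- `ran (A - z I)`. -/
def rangeSub (A : H →ₗ.[ℂ] H) (z : ℂ) : Submodule ℂ H :=
  LinearMap.range (A.toFun - z • A.domain.subtype)

/-- `ker (B - z I)`, as a subspace of `H` (it consists of `φ ∈ dom B` with `B φ = z φ`). -/
def kernelSub (B : H →ₗ.[ℂ] H) (z : ℂ) : Submodule ℂ H :=
  (LinearMap.ker (B.toFun - z • B.domain.subtype)).map B.domain.subtype

/-- The deficiency index `n₊(A) = dim ker (A* - i I)`. -/
def deficiencyIndexPos [CompleteSpace H] (A : H →ₗ.[ℂ] H) : Cardinal :=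
  Module.rank ℂ (kernelSub A.adjoint Complex.I)

/-- The deficiency index `n₋(A) = dim ker (A* + i I)`. -/
def deficiencyIndexNeg [CompleteSpace H] (A : H →ₗ.[ℂ] H) : Cardinal :=
  Module.rank ℂ (kernelSub A.adjoint (-Complex.I))

/-- Regular operators: closed operators `A` such that `A - z I` is bounded from below for
every `z ∈ ℂ`. -/
structure IsRegularOperator (A : H →ₗ.[ℂ] H) : Prop where
  isClosed : A.IsClosed
  bounded_below : ∀ z : ℂ, ∃ C : ℝ, 0 < C ∧
    ∀ φ : A.domain, C * ‖(φ : H)‖ ≤ ‖A φ - z • (φ : H)‖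

/-- The exceptional set `S_μ`: the points `z` where `H = ran (A - z I) ∔ span {μ}` fails. -/
def exceptionalSet (A : H →ₗ.[ℂ] H) (μ : H) : Set ℂ :=
  {z | ¬ IsCompl (rangeSub A z) (Submodule.span ℂ {μ})}

/-- `μ` is a gauge of `A`: `H = ran (A - z I) ∔ span {μ}` for all but at most countably
many `z`. -/
def IsGauge (A : H →ₗ.[ℂ] H) (μ : H) : Prop :=
  (exceptionalSet A μ).Countable

/-- An entire gauge is a gauge with empty exceptional set. -/
def IsEntireGauge (A : H →ₗ.[ℂ] H) (μ : H) : Prop :=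
  IsGauge A μ ∧ exceptionalSet A μ = ∅

/-- Entire operators in the sense of Krein: regular symmetric operators with deficiency indices
`(1, 1)` which have an entire gauge. -/
structure IsEntireOperator [CompleteSpace H] (A : H →ₗ.[ℂ] H) : Prop where
  regular : IsRegularOperator A
  symmetric : IsSymmetricOperator A
  deficiency_pos : deficiencyIndexPos A = 1
  deficiency_neg : deficiencyIndexNeg A = 1
  exists_gauge : ∃ μ : H, IsEntireGauge A μ

/-- A conjugation: an antilinear involution with `⟪I φ, I ψ⟫ = ⟪ψ, φ⟫`. -/
structure IsConjugation (I : H → H) : Prop where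
  map_add : ∀ φ ψ, I (φ + ψ) = I φ + I ψ
  map_smul : ∀ (c : ℂ) (φ : H), I (c • φ) = conj c • I φ
  involutive : ∀ φ, I (I φ) = φ
  inner_map : ∀ φ ψ, ⟪I φ, I ψ⟫_ℂ = ⟪ψ, φ⟫_ℂ

/-- `I` commutes with `A`: it maps `dom A` into itself and `A I φ = I A φ` on `dom A`. -/
def CommutesWith (I : H → H) (A : H →ₗ.[ℂ] H) : Prop :=
  ∀ φ : A.domain, ∃ h : I φ ∈ A.domain, A ⟨I φ, h⟩ = I (A φ)

/-- `ξ : ℂ → H` is a zero-free entire function with values `ξ z ∈ ker (A* - z I)`, which is real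
with respect to the conjugation `I`. -/
structure IsKreinFunction [CompleteSpace H] (A : H →ₗ.[ℂ] H) (I : H → H) (ξ : ℂ → H) : Prop where
  entire : Differentiable ℂ ξ
  zero_free : ∀ z, ξ z ≠ 0
  mem_kernel : ∀ z, ξ z ∈ kernelSub A.adjoint z
  real : ∀ z, I (ξ z) = ξ (conj z)

end Operators

/-! ### Jacobi operators -/

/-- The canonical basis vectors of `ℓ²(ℕ)`. -/
def canonicalVector (k : ℕ) : L2Seq := lp.single 2 k (1 : ℂ)

/-- The second order difference expression with diagonal `q` and off-diagonal `b`. -/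
def jacobiExpr (q b : ℕ → ℝ) (φ : ℕ → ℂ) : ℕ → ℂ
  | 0 => q 0 * φ 0 + b 0 * φ 1
  | k + 1 => b k * φ k + q (k + 1) * φ (k + 1) + b (k + 1) * φ (k + 2)

/-- The space of sequences with finitely many nonzero elements. -/
def finSeq : Submodule ℂ L2Seq where
  carrier := {φ | {k | φ k ≠ 0}.Finite}
  zero_mem' := by simp
  add_mem' := by
    intro φ ψ hφ hψ
    refine (Set.Finite.union hφ hψ).subset fun k hk => ?_
    by_contra hc
    simp only [Set.mem_union, not_or, Set.mem_ofPred_eq, not_not] at hc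
    exact hk (by simp [hc.1, hc.2])
  smul_mem' := by
    intro c φ hφ
    exact Set.Finite.subset hφ fun k hk hc => hk (by simp [hc])

theorem memlp_jacobiExpr (q b : ℕ → ℝ) (φ : finSeq) :
    Memℓp (jacobiExpr q b (φ : L2Seq)) 2 := by
  have h0 : Memℓp (jacobiExpr q b (φ : L2Seq)) 0 := by
    refine memℓp_zero ?_
    obtain ⟨N, hN⟩ := Set.Finite.bddAbove φ.2
    refine (Set.finite_Iic (N + 1)).subset fun k hk => ?_
    by_contra hc
    have hz : ∀ j, N < j → (φ : L2Seq) j = 0 := by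
      intro j hj
      by_contra hne
      exact absurd (hN hne) (by omega)
    simp only [Set.mem_Iic, not_le] at hc
    obtain ⟨m, rfl⟩ : ∃ m, k = m + 1 := ⟨k - 1, by omega⟩
    exact hk (by simp [jacobiExpr, hz m (by omega), hz (m + 1) (by omega), hz (m + 2) (by omega)])
  exact h0.of_exponent_ge bot_le

/-- The operator `J₀`: the difference expression on the finitely supported sequences. -/
def jacobiPre (q b : ℕ → ℝ) : L2Seq →ₗ.[ℂ] L2Seq where
  domain := finSeq
  toFun :=
    { toFun := fun φ => ⟨jacobiExpr q b (φ : L2Seq), memlp_jacobiExpr q b φ⟩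
      map_add' := by
        intro φ ψ
        ext k
        change jacobiExpr q b (fun j => (φ : L2Seq) j + (ψ : L2Seq) j) k
          = jacobiExpr q b (φ : L2Seq) k + jacobiExpr q b (ψ : L2Seq) k
        cases k <;> simp only [jacobiExpr] <;> ring
      map_smul' := by
        intro c φ
        ext k
        change jacobiExpr q b (fun j => c * (φ : L2Seq) j) k
          = c * jacobiExpr q b (φ : L2Seq) k
        cases k <;> simp only [jacobiExpr] <;> ring }

/-- The Jacobi operator `J`: the closure of `J₀`. -/
def jacobiOperator (q b : ℕ → ℝ) : L2Seq →ₗ.[ℂ] L2Seq := (jacobiPre q b).closure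

/-- The polynomials of the first kind generated by the Jacobi matrix, i.e. the solution of
`z π₁ = q₁ π₁ + b₁ π₂`, `z πₖ = bₖ₋₁ πₖ₋₁ + qₖ πₖ + bₖ πₖ₊₁` with `π₁ = 1`. -/
def firstKindPoly (q b : ℕ → ℝ) : ℕ → Polynomial ℝ
  | 0 => 1
  | 1 => Polynomial.C (b 0)⁻¹ * (Polynomial.X - Polynomial.C (q 0))
  | k + 2 => Polynomial.C (b (k + 1))⁻¹ *
      ((Polynomial.X - Polynomial.C (q (k + 1))) * firstKindPoly q b (k + 1)
        - Polynomial.C (b k) * firstKindPoly q b k)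

end

/-! The main point is that failure of selfadjointness makes every solution of the difference
equation square summable, for every spectral parameter. Since the double adjoint of `J₀` lies in its
closure, `J` would be selfadjoint if the adjoint of `J₀` were symmetric. Hence two sequences φ, ψ in
the maximal domain have a Wronskian with nonzero limit (`exists_tendsto_wronskian`). A solution u is
recovered from its Wronskians with φ and ψ (`mul_wronskian_eq`), and Green's formula bounds these by
sums of |u_k| against square summable weights. Grönwall's inequality then dominates u by a fixed
square summable sequence, locally uniformly in z (`exists_dominating_sequence`).

The rest follows from the solutions π(z), θ(z) of the first and second kind. Their Wronskian is 1,
so variation of constants bounds `J₀ - z` from below (`jacobiPre_bounded_below`), and the bound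
passes to the closure. The kernel of `J* - z` is spanned by π(z). Thus ran (J - z) is closed and
equals the orthogonal complement of π(z̄), and δ₁ is complementary to it because ⟪π(z̄), δ₁⟫ = 1.
Finally, the truncations of π(z) are polynomial in z and converge locally uniformly, so π is entire.
-/

section Operators

/-! ### Adjoints, closures and ranges of unbounded operators -/

variable {H : Type*} [NormedAddCommGroup H] [InnerProductSpace ℂ H]

/-- The double adjoint of a linear relation is contained in its closure. -/
theorem Submodule.adjoint_adjoint_le [CompleteSpace H] (g : Submodule ℂ (H × H)) :
    g.adjoint.adjoint ≤ g.topologicalClosure := by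
  intro x hx
  -- The product carries the sup norm; orthogonal complements require the equivalent Hilbert norm.
  set e : WithLp 2 (H × H) ≃L[ℂ] H × H := WithLp.prodContinuousLinearEquiv 2 ℂ H H with he
  set K : Submodule ℂ (WithLp 2 (H × H)) := g.comap e.toLinearEquiv.toLinearMap with hK
  have hx' : e.symm x ∈ K.topologicalClosure := by
    rw [← Submodule.orthogonal_orthogonal_eq_closure, Submodule.mem_orthogonal]
    intro y hy
    rw [Submodule.mem_orthogonal] at hy
    -- The adjoint relation is the orthogonal complement rotated by (a, b) ↦ (b, -a).
    have h1 : ((e y).2, -(e y).1) ∈ g.adjoint := by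
      rw [Submodule.mem_adjoint_iff]
      intro a b hab
      have := hy (e.symm (a, b)) (by simpa [hK] using hab)
      rw [WithLp.prod_inner_apply] at this
      simp only [inner_neg_right, sub_neg_eq_add]
      rw [add_comm]
      exact this
    have h2 := (Submodule.mem_adjoint_iff _ x).1 hx _ _ h1
    rw [WithLp.prod_inner_apply]
    rw [inner_neg_left] at h2
    have h3 : ⟪(e y).1, x.1⟫_ℂ + ⟪(e y).2, x.2⟫_ℂ = 0 := by linear_combination -h2
    exact h3
  rw [← SetLike.mem_coe, Submodule.topologicalClosure_coe] at hx' ⊢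
  have := image_closure_subset_closure_image e.continuous (s := (K : Set _))
    (Set.mem_image_of_mem e hx')
  rw [ContinuousLinearEquiv.apply_symm_apply] at this
  refine closure_mono ?_ this
  rintro _ ⟨w, hw, rfl⟩
  exact hw

theorem Submodule.adjoint_topologicalClosure (g : Submodule ℂ (H × H)) :
    g.topologicalClosure.adjoint = g.adjoint := by
  ext x
  simp only [Submodule.mem_adjoint_iff]
  refine ⟨fun h a b hab => h a b (g.le_topologicalClosure hab), fun h a b hab => ?_⟩
  have hc : IsClosed {p : H × H | ⟪p.2, x.1⟫_ℂ - ⟪p.1, x.2⟫_ℂ = 0} :=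
    isClosed_eq (by fun_prop) continuous_const
  have : closure (g : Set (H × H)) ⊆ {p : H × H | ⟪p.2, x.1⟫_ℂ - ⟪p.1, x.2⟫_ℂ = 0} :=
    closure_minimal (fun p hp => h p.1 p.2 hp) hc
  exact this hab

theorem mem_kernelSub_iff {B : H →ₗ.[ℂ] H} {z : ℂ} {x : H} :
    x ∈ kernelSub B z ↔ (x, z • x) ∈ B.graph := by
  simp only [kernelSub, Submodule.mem_map, LinearMap.mem_ker, LinearMap.sub_apply,
    LinearMap.smul_apply, sub_eq_zero, LinearPMap.mem_graph_iff, Submodule.subtype_apply]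
  constructor
  · rintro ⟨y, h, rfl⟩
    exact ⟨y, rfl, h⟩
  · rintro ⟨y, rfl, h⟩
    exact ⟨y, h, rfl⟩

theorem mem_rangeSub_iff {A : H →ₗ.[ℂ] H} {z : ℂ} {y : H} :
    y ∈ rangeSub A z ↔ ∃ x, (x, y + z • x) ∈ A.graph := by
  simp only [rangeSub, LinearMap.mem_range, LinearMap.sub_apply, LinearMap.smul_apply,
    LinearPMap.mem_graph_iff, Submodule.subtype_apply]
  constructor
  · rintro ⟨x, rfl⟩
    refine ⟨x, x, rfl, ?_⟩
    rw [sub_add_cancel]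
    rfl
  · rintro ⟨_, x, rfl, h⟩
    exact ⟨x, sub_eq_iff_eq_add.2 h⟩

namespace LinearPMap

theorem bounded_below_iff_graph {A : H →ₗ.[ℂ] H} {z : ℂ} {C : ℝ} :
    (∀ φ : A.domain, C * ‖(φ : H)‖ ≤ ‖A φ - z • (φ : H)‖) ↔
      ∀ p ∈ A.graph, C * ‖p.1‖ ≤ ‖p.2 - z • p.1‖ := by
  constructor
  · intro h p hp
    obtain ⟨y, h1, h2⟩ := A.mem_graph_iff.1 hp
    rw [← h1, ← h2]
    exact h y
  · intro h φ
    exact h _ (A.mem_graph φ)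

/-- The inequality is a closed condition on points of the graph, so it survives taking the closure
of the graph. -/
theorem IsClosable.bounded_below_closure {A : H →ₗ.[ℂ] H} (hA : A.IsClosable) {z : ℂ} {C : ℝ}
    (h : ∀ φ : A.domain, C * ‖(φ : H)‖ ≤ ‖A φ - z • (φ : H)‖) (φ : A.closure.domain) :
    C * ‖(φ : H)‖ ≤ ‖A.closure φ - z • (φ : H)‖ := by
  rw [bounded_below_iff_graph] at h
  revert φ
  rw [bounded_below_iff_graph, ← hA.graph_closure_eq_closure_graph]
  have hc : _root_.IsClosed {p : H × H | C * ‖p.1‖ ≤ ‖p.2 - z • p.1‖} :=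
    isClosed_le (by fun_prop) (by fun_prop)
  exact fun p hp => closure_minimal (fun p hp => h p hp) hc hp

theorem dense_domain_closure {T : H →ₗ.[ℂ] H} (hT : Dense (T.domain : Set H)) :
    Dense (T.closure.domain : Set H) :=
  hT.mono T.le_closure.1

variable [CompleteSpace H]

theorem isClosable_of_le_adjoint {T : H →ₗ.[ℂ] H} (hT : Dense (T.domain : Set H))
    (h : T ≤ T.adjoint) : T.IsClosable :=
  (adjoint_isClosed hT).isClosable.leIsClosable h

theorem adjoint_closure {T : H →ₗ.[ℂ] H} (hT : Dense (T.domain : Set H))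
    (hc : T.IsClosable) : T.closure.adjoint = T.adjoint := by
  apply eq_of_eq_graph
  rw [adjoint_graph_eq_graph_adjoint (dense_domain_closure hT), adjoint_graph_eq_graph_adjoint hT,
    ← hc.graph_closure_eq_closure_graph, Submodule.adjoint_topologicalClosure]

theorem closure_le_adjoint {T : H →ₗ.[ℂ] H} (hT : Dense (T.domain : Set H))
    (h : T ≤ T.adjoint) : T.closure ≤ T.adjoint := by
  rw [← le_graph_iff, ← (isClosable_of_le_adjoint hT h).graph_closure_eq_closure_graph]
  exact Submodule.topologicalClosure_minimal _ (le_graph_iff.2 h) (adjoint_isClosed hT)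

theorem isSymmetricOperator_closure {T : H →ₗ.[ℂ] H} (hT : Dense (T.domain : Set H))
    (h : T ≤ T.adjoint) : IsSymmetricOperator T.closure := by
  refine ⟨dense_domain_closure hT, fun x y => ?_⟩
  have hle := closure_le_adjoint hT h
  rw [← adjoint_closure hT (isClosable_of_le_adjoint hT h)] at hle
  have := adjoint_isFormalAdjoint (dense_domain_closure hT) ⟨x, hle.1 x.2⟩ y
  rwa [← hle.2 (x := x) rfl] at this

/-- If the adjoint of a symmetric operator is symmetric, the operator is essentially
selfadjoint. -/
theorem isSelfAdjoint_closure {T : H →ₗ.[ℂ] H} (hT : Dense (T.domain : Set H))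
    (h : T ≤ T.adjoint) (hs : T.adjoint.IsFormalAdjoint T.adjoint) :
    IsSelfAdjoint T.closure := by
  have hc := isClosable_of_le_adjoint hT h
  rw [isSelfAdjoint_def, adjoint_closure hT hc]
  refine le_antisymm ?_ (closure_le_adjoint hT h)
  rw [← le_graph_iff, ← hc.graph_closure_eq_closure_graph]
  -- Symmetry of the adjoint places its graph inside the double adjoint relation, hence inside the
  -- closure of the graph of `T`.
  refine le_trans ?_ (Submodule.adjoint_adjoint_le _)
  rw [← adjoint_graph_eq_graph_adjoint hT]
  rintro ⟨x, y⟩ hxy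
  obtain ⟨u, rfl, rfl⟩ := (mem_graph_iff _).1 hxy
  rw [Submodule.mem_adjoint_iff]
  intro a b hab
  obtain ⟨v, rfl, rfl⟩ := (mem_graph_iff _).1 hab
  exact sub_eq_zero.2 (hs v u)

theorem orthogonal_rangeSub {A : H →ₗ.[ℂ] H} (hA : Dense (A.domain : Set H)) (z : ℂ) :
    (rangeSub A z)ᗮ = kernelSub A.adjoint (conj z) := by
  ext x
  rw [mem_kernelSub_iff, adjoint_graph_eq_graph_adjoint hA, Submodule.mem_adjoint_iff,
    Submodule.mem_orthogonal]
  constructor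
  · intro h a b hab
    have := h (b - z • a) (mem_rangeSub_iff.2 ⟨a, by simpa using hab⟩)
    simpa [inner_sub_left, inner_smul_left, inner_smul_right] using this
  · intro h y hy
    obtain ⟨a, ha⟩ := mem_rangeSub_iff.1 hy
    have := h _ _ ha
    simpa [inner_add_left, inner_smul_left, inner_smul_right] using this

end LinearPMap

/-- The range is the image of the complete graph under (x, y) ↦ y - z x, which the lower bound makes
antilipschitz. -/
theorem IsRegularOperator.isClosed_rangeSub [CompleteSpace H] {A : H →ₗ.[ℂ] H}
    (hA : IsRegularOperator A) (z : ℂ) : IsClosed (rangeSub A z : Set H) := by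
  obtain ⟨C, hC, h⟩ := hA.bounded_below z
  rw [LinearPMap.bounded_below_iff_graph] at h
  have hg : IsComplete (A.graph : Set (H × H)) := IsClosed.isComplete hA.isClosed
  have hu : UniformContinuous fun p : A.graph => (p : H × H).2 - z • (p : H × H).1 :=
    ((ContinuousLinearMap.snd ℂ H H - z • ContinuousLinearMap.fst ℂ H H).comp
      A.graph.subtypeL).uniformContinuous
  have hb : ∀ p ∈ A.graph, ‖p‖ ≤ (1 + (1 + ‖z‖) / C) * ‖p.2 - z • p.1‖ := by
    intro p hp
    have h1 : ‖p.1‖ ≤ ‖p.2 - z • p.1‖ / C := by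
      rw [le_div_iff₀ hC, mul_comm]; exact h p hp
    have h2 : ‖p.2‖ ≤ ‖p.2 - z • p.1‖ + ‖z‖ * ‖p.1‖ := by
      calc ‖p.2‖ = ‖(p.2 - z • p.1) + z • p.1‖ := by rw [sub_add_cancel]
        _ ≤ _ := (norm_add_le _ _).trans_eq (by rw [norm_smul])
    have h3 : ‖z‖ * ‖p.1‖ ≤ ‖z‖ * (‖p.2 - z • p.1‖ / C) := by gcongr
    have h4 : (1 + (1 + ‖z‖) / C) * ‖p.2 - z • p.1‖
        = ‖p.2 - z • p.1‖ + ‖p.2 - z • p.1‖ / C + ‖z‖ * (‖p.2 - z • p.1‖ / C) := by ring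
    have h5 : 0 ≤ ‖p.2 - z • p.1‖ / C := by positivity
    have h6 : 0 ≤ ‖z‖ * (‖p.2 - z • p.1‖ / C) := by positivity
    rw [h4, Prod.norm_def]
    refine max_le ?_ ?_
    · linarith [norm_nonneg (p.2 - z • p.1)]
    · linarith
  set f : A.graph →L[ℂ] H :=
    (ContinuousLinearMap.snd ℂ H H - z • ContinuousLinearMap.fst ℂ H H).comp A.graph.subtypeL
  have hf : AntilipschitzWith (Real.toNNReal (1 + (1 + ‖z‖) / C)) f := by
    refine AddMonoidHomClass.antilipschitz_of_bound f fun p => ?_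
    rw [Real.coe_toNNReal _ (by positivity)]
    exact hb p p.2
  have : CompleteSpace A.graph := hg.completeSpace_coe
  have hr := hf.isClosed_range hu
  convert hr
  ext y
  rw [SetLike.mem_coe, mem_rangeSub_iff]
  constructor
  · rintro ⟨x, hx⟩
    exact ⟨⟨_, hx⟩, add_sub_cancel_right y _⟩
  · rintro ⟨⟨p, hp⟩, rfl⟩
    exact ⟨p.1, by simpa [f] using hp⟩

/-- A vector not orthogonal to the one-dimensional deficiency spaces of a regular operator is
complementary to the range. -/
theorem IsRegularOperator.isCompl_span [CompleteSpace H] {A : H →ₗ.[ℂ] H}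
    (hA : IsRegularOperator A) (hd : Dense (A.domain : Set H)) {z : ℂ} {v μ : H}
    (hv : kernelSub A.adjoint (conj z) = Submodule.span ℂ {v}) (hμ : ⟪v, μ⟫_ℂ ≠ 0) :
    IsCompl (rangeSub A z) (Submodule.span ℂ {μ}) := by
  have hran : rangeSub A z = (Submodule.span ℂ {v})ᗮ := by
    rw [← hv, ← LinearPMap.orthogonal_rangeSub hd, Submodule.orthogonal_orthogonal_eq_closure]
    exact (IsClosed.submodule_topologicalClosure_eq (hA.isClosed_rangeSub z)).symm
  rw [hran]
  refine ⟨Submodule.disjoint_def.2 fun x hx hxμ => ?_, ?_⟩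
  · obtain ⟨c, rfl⟩ := Submodule.mem_span_singleton.1 hxμ
    rw [Submodule.mem_orthogonal_singleton_iff_inner_right, inner_smul_right] at hx
    rw [(mul_eq_zero.1 hx).resolve_right hμ, zero_smul]
  · rw [codisjoint_iff, Submodule.eq_top_iff']
    intro x
    rw [Submodule.mem_sup]
    -- Oblique projection along μ onto the orthogonal complement of v.
    refine ⟨x - (⟪v, x⟫_ℂ / ⟪v, μ⟫_ℂ) • μ, ?_, (⟪v, x⟫_ℂ / ⟪v, μ⟫_ℂ) • μ,
      Submodule.smul_mem _ _ (Submodule.mem_span_singleton_self μ), sub_add_cancel _ _⟩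
    rw [Submodule.mem_orthogonal_singleton_iff_inner_right, inner_sub_right, inner_smul_right,
      div_mul_cancel₀ _ hμ, sub_self]

end Operators

/-! ### Second order difference equations -/

/-- The Wronskian (Casoratian) of two sequences. -/
def wronskian (b : ℕ → ℝ) (u v : ℕ → ℂ) (n : ℕ) : ℂ := b n * (u n * v (n + 1) - u (n + 1) * v n)

/-- Green's formula for the difference expression. -/
theorem sum_jacobiExpr_eq_wronskian (q b : ℕ → ℝ) (u v : ℕ → ℂ) (n : ℕ) :
    ∑ k ∈ Finset.range (n + 1), (u k * jacobiExpr q b v k - jacobiExpr q b u k * v k)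
      = wronskian b u v n := by
  induction n with
  | zero => simp [jacobiExpr, wronskian]; ring
  | succ n ih =>
    rw [Finset.sum_range_succ, ih]
    simp only [jacobiExpr, wronskian]
    ring

/-- A purely algebraic identity: when the Wronskian of φ and ψ stays away from zero, it recovers u
from its Wronskians with φ and ψ. -/
theorem mul_wronskian_eq (b : ℕ → ℝ) (u φ ψ : ℕ → ℂ) (n : ℕ) :
    u (n + 1) * wronskian b φ ψ n
      = φ (n + 1) * wronskian b u ψ n - ψ (n + 1) * wronskian b u φ n := by
  simp only [wronskian]
  ring

/-- `u` solves the inhomogeneous equation `τ u = z u + c δ₁` for the difference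
expression `τ`. -/
def IsJacobiSolution (q b : ℕ → ℝ) (z c : ℂ) (u : ℕ → ℂ) : Prop :=
  ∀ k, jacobiExpr q b u k = z * u k + if k = 0 then c else 0

/-- In Green's formula the equation for u moves z onto v, and the source at the first site leaves
only the term c v₀. -/
theorem IsJacobiSolution.wronskian_eq {q b : ℕ → ℝ} {z c : ℂ} {u : ℕ → ℂ}
    (hu : IsJacobiSolution q b z c u) (v : ℕ → ℂ) (n : ℕ) :
    wronskian b u v n
      = ∑ k ∈ Finset.range (n + 1), u k * (jacobiExpr q b v k - z * v k) - c * v 0 := by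
  rw [← sum_jacobiExpr_eq_wronskian q, eq_sub_iff_add_eq]
  have : c * v 0 = ∑ k ∈ Finset.range (n + 1), if k = 0 then c * v k else 0 := by
    rw [Finset.sum_ite_eq' (Finset.range (n + 1)) 0 (fun k => c * v k)]
    simp
  rw [this, ← Finset.sum_add_distrib]
  refine Finset.sum_congr rfl fun k _ => ?_
  rw [hu k]
  split_ifs <;> ring

theorem IsJacobiSolution.norm_wronskian_le {q b : ℕ → ℝ} {z c : ℂ} {u : ℕ → ℂ}
    (hu : IsJacobiSolution q b z c u) (v : ℕ → ℂ) {R : ℝ} (hz : ‖z‖ ≤ R) (n : ℕ) :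
    ‖wronskian b u v n‖ ≤ ‖v 0‖ * ‖c‖ +
      ∑ k ∈ Finset.range (n + 1), (‖jacobiExpr q b v k‖ + R * ‖v k‖) * ‖u k‖ := by
  rw [hu.wronskian_eq]
  refine (norm_sub_le _ _).trans ?_
  rw [norm_mul c, mul_comm ‖c‖, add_comm]
  refine add_le_add le_rfl ?_
  refine (norm_sum_le _ _).trans (Finset.sum_le_sum fun k _ => ?_)
  rw [norm_mul, mul_comm]
  gcongr
  refine (norm_sub_le _ _).trans ?_
  rw [norm_mul]
  gcongr

/-! ### Square summable domination of solutions -/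

/-- A Grönwall inequality for sequences controlled by the weighted sums of their predecessors. -/
theorem le_mul_exp_of_le_mul_sum {a h g : ℕ → ℝ} {K : ℝ} {N : ℕ} (hK : 0 ≤ K)
    (ha : ∀ n, 0 ≤ a n) (hh : ∀ n, 0 ≤ h n) (hg : ∀ n, 0 ≤ g n)
    (hs : Summable fun n => g n * h n)
    (H : ∀ n ≥ N, a (n + 1) ≤ h (n + 1) * (K + ∑ k ∈ Finset.range (n + 1), g k * a k))
    {n : ℕ} (hn : N ≤ n) :
    a (n + 1) ≤ h (n + 1) * ((K + ∑ k ∈ Finset.range (N + 1), g k * a k)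
      * Real.exp (∑' k, g k * h k)) := by
  set U : ℕ → ℝ := fun n => K + ∑ k ∈ Finset.range (n + 1), g k * a k with hU
  have hU0 : ∀ n, 0 ≤ U n := fun n =>
    add_nonneg hK (Finset.sum_nonneg fun k _ => mul_nonneg (hg k) (ha k))
  refine (H n hn).trans (mul_le_mul_of_nonneg_left ?_ (hh _))
  -- The zero last term is the forcing term expected by `discrete_gronwall`.
  have hstep : ∀ n ≥ N, U (n + 1) ≤ (1 + g (n + 1) * h (n + 1)) * U n + (fun _ => (0 : ℝ)) n := by
    intro n hn
    have h1 : U (n + 1) = U n + g (n + 1) * a (n + 1) := by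
      simp only [hU]
      rw [Finset.sum_range_succ _ (n + 1)]
      ring
    have h2 := mul_le_mul_of_nonneg_left (H n hn) (hg (n + 1))
    change g (n + 1) * a (n + 1) ≤ g (n + 1) * (h (n + 1) * U n) at h2
    rw [h1]
    simp only [add_zero]
    linarith
  have key := discrete_gronwall (hU0 N) hstep
    (fun n _ => mul_nonneg (hg _) (hh _)) (fun _ _ => le_rfl) hn
  simp only [Finset.sum_const_zero, add_zero] at key
  refine key.trans (mul_le_mul_of_nonneg_left (Real.exp_le_exp.2 ?_) (hU0 N))
  have hs' : Summable fun k => g (k + 1) * h (k + 1) := (summable_nat_add_iff 1).2 hs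
  calc ∑ i ∈ Finset.Ico N n, g (i + 1) * h (i + 1) ≤ ∑' k, g (k + 1) * h (k + 1) :=
        hs'.sum_le_tsum _ fun k _ => mul_nonneg (hg _) (hh _)
    _ ≤ ∑' k, g k * h k := by
        rw [hs.tsum_eq_zero_add]
        exact le_add_of_nonneg_left (mul_nonneg (hg _) (hh _))

theorem Memℓp.summable_mul_two {f g : ℕ → ℝ} (hf : Memℓp f 2) (hg : Memℓp g 2) :
    Summable fun n => f n * g n := by
  have := lp.summable_inner (𝕜 := ℝ) (⟨g, hg⟩ : lp (fun _ : ℕ => ℝ) 2) ⟨f, hf⟩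
  simpa using this

/-- If two square summable sequences with square summable images have a nonzero Wronskian at
infinity, all the solutions of the difference equations are dominated by a fixed square summable
sequence, locally uniformly in the spectral parameter. -/
theorem exists_dominating_sequence {q b : ℕ → ℝ} {φ ψ : ℕ → ℂ} (hφ : Memℓp φ 2) (hψ : Memℓp ψ 2)
    (hφ' : Memℓp (jacobiExpr q b φ) 2) (hψ' : Memℓp (jacobiExpr q b ψ) 2) {L : ℂ} (hL : L ≠ 0)
    (hW : Filter.Tendsto (wronskian b φ ψ) Filter.atTop (nhds L)) :
    ∃ (N : ℕ) (h : ℕ → ℝ), Memℓp h 2 ∧ (∀ n, 0 ≤ h n) ∧ ∀ R : ℝ, 0 ≤ R → ∃ C : ℝ, 0 ≤ C ∧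
      ∀ z c u, ‖z‖ ≤ R → IsJacobiSolution q b z c u → ∀ n ≥ N,
        ‖u (n + 1)‖ ≤ h (n + 1) * (C * (‖c‖ + ∑ k ∈ Finset.range (N + 1), ‖u k‖)) := by
  set ε : ℝ := ‖L‖ / 2 with hε
  have hε0 : 0 < ε := by positivity
  obtain ⟨N, hN⟩ : ∃ N, ∀ n ≥ N, ε ≤ ‖wronskian b φ ψ n‖ := by
    have : ∀ᶠ n in Filter.atTop, ε < ‖wronskian b φ ψ n‖ :=
      hW.norm.eventually_const_lt (half_lt_self (norm_pos_iff.2 hL))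
    obtain ⟨N, hN⟩ := Filter.eventually_atTop.1 this
    exact ⟨N, fun n hn => (hN n hn).le⟩
  set h : ℕ → ℝ := fun n => ε⁻¹ * (‖φ n‖ + ‖ψ n‖) with hh
  have hhmem : Memℓp h 2 := (hφ.norm.add hψ.norm).const_mul ε⁻¹
  have hh0 : ∀ n, 0 ≤ h n := fun n => by positivity
  refine ⟨N, h, hhmem, hh0, fun R hR => ?_⟩
  -- A common weight for the Wronskians of u with both φ and ψ, uniform over ‖z‖ ≤ R.
  set g : ℕ → ℝ := fun n =>
    (‖jacobiExpr q b φ n‖ + R * ‖φ n‖) + (‖jacobiExpr q b ψ n‖ + R * ‖ψ n‖) with hg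
  have hgmem : Memℓp g 2 :=
    (hφ'.norm.add (hφ.norm.const_mul R)).add (hψ'.norm.add (hψ.norm.const_mul R))
  have hg0 : ∀ n, 0 ≤ g n := fun n => by positivity
  set E := Real.exp (∑' k, g k * h k)
  set K := ‖φ 0‖ + ‖ψ 0‖
  set G := ∑ k ∈ Finset.range (N + 1), g k
  have hG : 0 ≤ G := Finset.sum_nonneg fun k _ => hg0 k
  refine ⟨(K + G) * E, by positivity, fun z c u hz hu n hn => ?_⟩
  have H : ∀ n ≥ N, ‖u (n + 1)‖ ≤
      h (n + 1) * (K * ‖c‖ + ∑ k ∈ Finset.range (n + 1), g k * ‖u k‖) := by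
    intro n hn
    set S := K * ‖c‖ + ∑ k ∈ Finset.range (n + 1), g k * ‖u k‖
    have h1 : ‖wronskian b u ψ n‖ ≤ S := by
      refine (hu.norm_wronskian_le ψ hz n).trans (add_le_add ?_ (Finset.sum_le_sum fun k _ => ?_))
      · exact mul_le_mul_of_nonneg_right (le_add_of_nonneg_left (norm_nonneg _)) (norm_nonneg _)
      · exact mul_le_mul_of_nonneg_right (le_add_of_nonneg_left (by positivity)) (norm_nonneg _)
    have h2 : ‖wronskian b u φ n‖ ≤ S := by
      refine (hu.norm_wronskian_le φ hz n).trans (add_le_add ?_ (Finset.sum_le_sum fun k _ => ?_))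
      · exact mul_le_mul_of_nonneg_right (le_add_of_nonneg_right (norm_nonneg _)) (norm_nonneg _)
      · exact mul_le_mul_of_nonneg_right (le_add_of_nonneg_right (by positivity)) (norm_nonneg _)
    have h3 : ‖u (n + 1)‖ * ε ≤ (‖φ (n + 1)‖ + ‖ψ (n + 1)‖) * S := by
      calc ‖u (n + 1)‖ * ε ≤ ‖u (n + 1)‖ * ‖wronskian b φ ψ n‖ := by gcongr; exact hN n hn
        _ = ‖φ (n + 1) * wronskian b u ψ n - ψ (n + 1) * wronskian b u φ n‖ := by
            rw [← norm_mul, mul_wronskian_eq]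
        _ ≤ ‖φ (n + 1)‖ * ‖wronskian b u ψ n‖ + ‖ψ (n + 1)‖ * ‖wronskian b u φ n‖ := by
            rw [← norm_mul, ← norm_mul]; exact norm_sub_le _ _
        _ ≤ ‖φ (n + 1)‖ * S + ‖ψ (n + 1)‖ * S := by gcongr
        _ = _ := by ring
    rw [← le_div_iff₀ hε0] at h3
    refine h3.trans_eq ?_
    simp only [hh]
    field_simp
  refine (le_mul_exp_of_le_mul_sum (a := fun n => ‖u n‖) (by positivity) (fun _ => norm_nonneg _)
    hh0 hg0 (hgmem.summable_mul_two hhmem) H hn).trans (mul_le_mul_of_nonneg_left ?_ (hh0 _))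
  rw [mul_right_comm]
  refine mul_le_mul_of_nonneg_right ?_ (Real.exp_pos _).le
  have hA : 0 ≤ ∑ k ∈ Finset.range (N + 1), ‖u k‖ := Finset.sum_nonneg fun k _ => norm_nonneg _
  have h4 : ∑ k ∈ Finset.range (N + 1), g k * ‖u k‖ ≤ G * ∑ k ∈ Finset.range (N + 1), ‖u k‖ := by
    rw [Finset.sum_mul]
    refine Finset.sum_le_sum fun k hk => mul_le_mul_of_nonneg_left ?_ (hg0 k)
    exact Finset.single_le_sum (fun k _ => norm_nonneg (u k)) hk
  have hK : 0 ≤ K := by positivity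
  nlinarith [mul_nonneg hK hA, mul_nonneg hG (norm_nonneg c)]

theorem memℓp_of_eventually_le {u : ℕ → ℂ} {h : ℕ → ℝ} (hh : Memℓp h 2) {N : ℕ}
    (hu : ∀ n ≥ N, ‖u (n + 1)‖ ≤ h (n + 1)) : Memℓp u 2 := by
  rw [memℓp_gen_iff (by norm_num)] at hh ⊢
  rw [← summable_nat_add_iff (N + 1)] at hh ⊢
  refine Summable.of_nonneg_of_le (fun n => by positivity) (fun n => ?_) hh
  have := (hu (n + N) (by omega)).trans (le_abs_self _)
  exact Real.rpow_le_rpow (norm_nonneg _) this (by norm_num)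

/-! ### The polynomials of the first and of the second kind -/

theorem isJacobiSolution_firstKindPoly {q b : ℕ → ℝ} (hb : ∀ k, 0 < b k) (z : ℂ) :
    IsJacobiSolution q b z 0 fun k => Polynomial.aeval z (firstKindPoly q b k) := by
  have hb' : ∀ k, (b k : ℂ) ≠ 0 := fun k => Complex.ofReal_ne_zero.2 (hb k).ne'
  intro k
  cases k with
  | zero =>
    simp only [jacobiExpr, firstKindPoly, map_one, map_mul, map_sub, Polynomial.aeval_C,
      Polynomial.aeval_X, Complex.coe_algebraMap, Complex.ofReal_inv]
    field_simp [hb' 0]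
    simp
  | succ k =>
    simp only [jacobiExpr, firstKindPoly, map_mul, map_sub, Polynomial.aeval_C,
      Polynomial.aeval_X, Complex.coe_algebraMap, Complex.ofReal_inv]
    have := hb' (k + 1)
    field_simp
    simp
    ring

/-- The polynomials of the second kind, evaluated at `z`. -/
noncomputable def secondKind (q b : ℕ → ℝ) (z : ℂ) : ℕ → ℂ
  | 0 => 0
  | k + 1 => (b 0 : ℂ)⁻¹ * Polynomial.aeval z
      (firstKindPoly (fun j => q (j + 1)) (fun j => b (j + 1)) k)

/-- These are the first-kind polynomials of the matrix with its first row and column removed,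
shifted by one site. The factor 1 / b₀ makes the source equal to 1. -/
theorem isJacobiSolution_secondKind {q b : ℕ → ℝ} (hb : ∀ k, 0 < b k) (z : ℂ) :
    IsJacobiSolution q b z 1 (secondKind q b z) := by
  have hb' : ∀ k, (b k : ℂ) ≠ 0 := fun k => Complex.ofReal_ne_zero.2 (hb k).ne'
  have h := isJacobiSolution_firstKindPoly (q := fun j => q (j + 1)) (b := fun j => b (j + 1))
    (fun k => hb (k + 1)) z
  intro k
  match k with
  | 0 => simp [jacobiExpr, secondKind, firstKindPoly, hb' 0]
  | 1 =>
    have := h 0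
    simp only [jacobiExpr, if_true, add_zero] at this
    simp only [jacobiExpr, secondKind]
    simp
    linear_combination (b 0 : ℂ)⁻¹ * this
  | k + 2 =>
    have := h (k + 1)
    simp only [jacobiExpr, Nat.add_eq_zero_iff, one_ne_zero, and_false, if_false] at this
    simp only [jacobiExpr, secondKind]
    simp
    linear_combination (b 0 : ℂ)⁻¹ * this

/-- Since no b_k vanishes, the recurrence determines every entry from the initial value. -/
theorem IsJacobiSolution.eq_mul_firstKindPoly {q b : ℕ → ℝ} (hb : ∀ k, 0 < b k) {z : ℂ}
    {u : ℕ → ℂ} (hu : IsJacobiSolution q b z 0 u) (n : ℕ) :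
    u n = u 0 * Polynomial.aeval z (firstKindPoly q b n) := by
  have hb' : ∀ k, (b k : ℂ) ≠ 0 := fun k => Complex.ofReal_ne_zero.2 (hb k).ne'
  have hπ := isJacobiSolution_firstKindPoly (q := q) hb z
  induction n using Nat.strong_induction_on with
  | _ n ih =>
    match n with
    | 0 => simp [firstKindPoly]
    | 1 =>
      have h1 := hu 0
      have h2 := hπ 0
      have h0 := ih 0 (by omega)
      simp only [jacobiExpr, if_true] at h1 h2
      refine mul_left_cancel₀ (hb' 0) ?_
      linear_combination h1 - u 0 * h2 + (z - q 0) * h0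
    | k + 2 =>
      have h1 := hu (k + 1)
      have h2 := hπ (k + 1)
      have e0 := ih k (by omega)
      have e1 := ih (k + 1) (by omega)
      simp only [jacobiExpr, Nat.add_eq_zero_iff, one_ne_zero, and_false, if_false] at h1 h2
      refine mul_left_cancel₀ (hb' (k + 1)) ?_
      linear_combination h1 - u 0 * h2 + (z - q (k + 1)) * e1 - b k * e0

theorem conj_aeval_firstKindPoly (q b : ℕ → ℝ) (z : ℂ) (k : ℕ) :
    conj (Polynomial.aeval z (firstKindPoly q b k))
      = Polynomial.aeval (conj z) (firstKindPoly q b k) :=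
  (Polynomial.aeval_conj _ _).symm

/-! ### The operator on finitely supported sequences and its adjoint -/

theorem exists_forall_ge_eq_zero {φ : L2Seq} (hφ : φ ∈ finSeq) : ∃ N, ∀ n ≥ N, φ n = 0 := by
  obtain ⟨N, hN⟩ := Set.Finite.bddAbove hφ
  refine ⟨N + 1, fun n hn => ?_⟩
  by_contra hne
  exact absurd (hN hne) (by omega)

theorem canonicalVector_mem_finSeq (k : ℕ) : canonicalVector k ∈ finSeq := by
  refine (Set.finite_singleton k).subset fun j hj => ?_
  by_contra hne
  exact hj (lp.single_apply_ne 2 k 1 hne)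

theorem dense_finSeq : Dense (finSeq : Set L2Seq) := by
  intro f
  refine mem_closure_of_tendsto (lp.hasSum_single (by norm_num) f)
    (Filter.Eventually.of_forall fun s => ?_)
  refine Submodule.sum_mem _ fun k _ => ?_
  have : lp.single 2 k (f k) = f k • canonicalVector k := by
    rw [canonicalVector, ← lp.single_smul, smul_eq_mul, mul_one]
  rw [this]
  exact finSeq.smul_mem _ (canonicalVector_mem_finSeq k)

theorem jacobiPre_apply (q b : ℕ → ℝ) (φ : finSeq) (k : ℕ) :
    (jacobiPre q b φ : L2Seq) k = jacobiExpr q b (φ : L2Seq) k :=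
  rfl

theorem jacobiExpr_conj (q b : ℕ → ℝ) (φ : ℕ → ℂ) (k : ℕ) :
    jacobiExpr q b (fun j => conj (φ j)) k = conj (jacobiExpr q b φ k) := by
  cases k <;> simp [jacobiExpr]

theorem inner_eq_sum_range {φ : L2Seq} {n : ℕ} (hφ : ∀ k ≥ n, φ k = 0) (ψ : L2Seq) :
    ⟪φ, ψ⟫_ℂ = ∑ k ∈ Finset.range n, conj (φ k) * ψ k := by
  rw [lp.inner_eq_tsum, tsum_eq_sum (s := Finset.range n)]
  · exact Finset.sum_congr rfl fun k _ => by rw [RCLike.inner_apply, mul_comm]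
  · intro k hk
    rw [hφ k (by simpa using hk), inner_zero_left]

/-- The boundary term at n vanishes because φ is zero from n on. The sum runs to n inclusive because
applying the difference expression enlarges the support by one site. -/
theorem inner_jacobiPre (q b : ℕ → ℝ) {φ : finSeq} {n : ℕ} (hφ : ∀ k ≥ n, (φ : L2Seq) k = 0)
    (ψ : L2Seq) :
    ⟪jacobiPre q b φ, ψ⟫_ℂ
      = ∑ k ∈ Finset.range (n + 1), conj ((φ : L2Seq) k) * jacobiExpr q b ψ k := by
  rw [inner_eq_sum_range (n := n + 1)]
  · have h := sum_jacobiExpr_eq_wronskian q b (fun j => conj ((φ : L2Seq) j)) ψ n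
    rw [Finset.sum_sub_distrib] at h
    simp only [wronskian, hφ n le_rfl, hφ (n + 1) (by omega), map_zero, zero_mul, sub_zero,
      mul_zero, jacobiExpr_conj] at h
    exact (sub_eq_zero.1 h).symm
  · intro k hk
    obtain ⟨m, rfl⟩ : ∃ m, k = m + 1 := ⟨k - 1, by omega⟩
    simp [jacobiPre_apply, jacobiExpr, hφ m (by omega), hφ (m + 1) (by omega),
      hφ (m + 2) (by omega)]

theorem dense_domain_jacobiPre (q b : ℕ → ℝ) : Dense ((jacobiPre q b).domain : Set L2Seq) :=
  dense_finSeq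

/-- The adjoint of the Jacobi operator is the maximal operator of the difference expression. -/
theorem mem_graph_adjoint_jacobiPre (q b : ℕ → ℝ) (x : L2Seq × L2Seq) :
    x ∈ (jacobiPre q b).adjoint.graph ↔ ∀ k, x.2 k = jacobiExpr q b x.1 k := by
  rw [LinearPMap.adjoint_graph_eq_graph_adjoint (dense_domain_jacobiPre q b),
    Submodule.mem_adjoint_iff]
  constructor
  · intro h k
    let e : finSeq := ⟨canonicalVector k, canonicalVector_mem_finSeq k⟩
    have h1 : ⟪jacobiPre q b e, x.1⟫_ℂ - ⟪(e : L2Seq), x.2⟫_ℂ = 0 :=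
      h _ _ ((jacobiPre q b).mem_graph e)
    have h0 : ∀ j ≥ k + 1, (e : L2Seq) j = 0 := fun j hj =>
      lp.single_apply_ne 2 k 1 (by omega)
    rw [inner_jacobiPre q b h0, inner_eq_sum_range (n := k + 1 + 1) (fun j hj => h0 j (by omega)),
      ← Finset.sum_sub_distrib, Finset.sum_eq_single k] at h1
    · simp only [e, canonicalVector, lp.single_apply_self, map_one, one_mul] at h1
      exact (sub_eq_zero.1 h1).symm
    · intro j _ hj
      have hej : (e : L2Seq) j = 0 := lp.single_apply_ne 2 k 1 hj
      rw [hej, map_zero, zero_mul, zero_mul, sub_zero]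
    · intro hk
      exact absurd (Finset.mem_range.2 (by omega)) hk
  · intro h a c hac
    obtain ⟨φ, rfl, rfl⟩ := (LinearPMap.mem_graph_iff _).1 hac
    obtain ⟨N, hN⟩ := exists_forall_ge_eq_zero φ.2
    rw [inner_jacobiPre q b hN, inner_eq_sum_range (n := N + 1) (fun j hj => hN j (by omega)),
      sub_eq_zero]
    exact Finset.sum_congr rfl fun k _ => by rw [h k]

theorem jacobiPre_le_adjoint (q b : ℕ → ℝ) : jacobiPre q b ≤ (jacobiPre q b).adjoint := by
  rw [← LinearPMap.le_graph_iff]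
  intro x hx
  obtain ⟨φ, h1, h2⟩ := (LinearPMap.mem_graph_iff _).1 hx
  rw [mem_graph_adjoint_jacobiPre]
  intro k
  rw [← h1, ← h2]
  rfl

theorem isClosable_jacobiPre (q b : ℕ → ℝ) : (jacobiPre q b).IsClosable :=
  LinearPMap.isClosable_of_le_adjoint (dense_domain_jacobiPre q b) (jacobiPre_le_adjoint q b)

theorem adjoint_jacobiOperator (q b : ℕ → ℝ) :
    (jacobiOperator q b).adjoint = (jacobiPre q b).adjoint :=
  LinearPMap.adjoint_closure (dense_domain_jacobiPre q b) (isClosable_jacobiPre q b)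

theorem mem_kernelSub_adjoint_jacobiOperator {q b : ℕ → ℝ} {z : ℂ} {φ : L2Seq} :
    φ ∈ kernelSub (jacobiOperator q b).adjoint z ↔ IsJacobiSolution q b z 0 φ := by
  rw [mem_kernelSub_iff, adjoint_jacobiOperator, mem_graph_adjoint_jacobiPre]
  refine forall_congr' fun k => ?_
  simp only [ite_self, add_zero]
  exact eq_comm

/-! ### The canonical conjugation -/

theorem inner_star_star (φ ψ : L2Seq) : ⟪star φ, star ψ⟫_ℂ = ⟪ψ, φ⟫_ℂ := by
  rw [lp.inner_eq_tsum, lp.inner_eq_tsum]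
  refine tsum_congr fun k => ?_
  rw [lp.star_apply, lp.star_apply, RCLike.inner_apply, RCLike.inner_apply, starRingEnd_apply,
    starRingEnd_apply, star_star, mul_comm]

theorem isConjugation_star : IsConjugation (fun φ : L2Seq => star φ) where
  map_add := star_add
  map_smul := star_smul
  involutive := star_star
  inner_map := inner_star_star

theorem commutesWith_star_jacobiOperator (q b : ℕ → ℝ) :
    CommutesWith (fun φ : L2Seq => star φ) (jacobiOperator q b) := by
  -- The coefficients are real, so conjugation preserves the graph of `J₀`; by continuity it
  -- preserves the closure.
  have hmaps : Set.MapsTo (fun p : L2Seq × L2Seq => (star p.1, star p.2))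
      (closure ((jacobiPre q b).graph : Set (L2Seq × L2Seq)))
      (closure ((jacobiPre q b).graph : Set (L2Seq × L2Seq))) := by
    refine Set.MapsTo.closure (fun p hp => ?_) (by fun_prop)
    obtain ⟨φ, h1, h2⟩ := (LinearPMap.mem_graph_iff _).1 hp
    have hmem : star p.1 ∈ finSeq := by
      refine Set.Finite.subset φ.2 fun k hk hc => hk ?_
      rw [lp.star_apply, ← h1, hc, star_zero]
    refine (LinearPMap.mem_graph_iff _).2 ⟨⟨star p.1, hmem⟩, rfl, ?_⟩
    ext k
    have h3 : p.2 k = jacobiExpr q b p.1 k := by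
      rw [← h1, ← h2]
      rfl
    calc jacobiExpr q b (fun j => conj (p.1 j)) k = conj (jacobiExpr q b p.1 k) :=
          jacobiExpr_conj q b _ k
      _ = conj (p.2 k) := by rw [h3]
  have hg : (jacobiOperator q b).graph = (jacobiPre q b).graph.topologicalClosure :=
    (isClosable_jacobiPre q b).graph_closure_eq_closure_graph.symm
  intro φ
  have h1 := (jacobiOperator q b).mem_graph φ
  rw [hg] at h1
  have h2 : (star (φ : L2Seq), star (jacobiOperator q b φ)) ∈ (jacobiOperator q b).graph := by
    rw [hg]
    exact hmaps h1
  obtain ⟨ψ, h3, h4⟩ := (LinearPMap.mem_graph_iff _).1 h2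
  replace h3 : (ψ : L2Seq) = star (φ : L2Seq) := h3
  have hmem : star (φ : L2Seq) ∈ (jacobiOperator q b).domain := h3 ▸ ψ.2
  refine ⟨hmem, ?_⟩
  refine Eq.trans ?_ h4
  congr 1
  exact Subtype.ext h3.symm

/-! ### Jacobi operators which are not selfadjoint -/

/-- If the Jacobi operator is not selfadjoint, then the boundary form at infinity is not zero. -/
theorem exists_tendsto_wronskian {q b : ℕ → ℝ} (hJ : ¬ IsSelfAdjoint (jacobiOperator q b)) :
    ∃ φ ψ : ℕ → ℂ, Memℓp φ 2 ∧ Memℓp ψ 2 ∧ Memℓp (jacobiExpr q b φ) 2 ∧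
      Memℓp (jacobiExpr q b ψ) 2 ∧ ∃ L : ℂ, L ≠ 0 ∧
      Filter.Tendsto (wronskian b φ ψ) Filter.atTop (nhds L) := by
  have hns : ¬ (jacobiPre q b).adjoint.IsFormalAdjoint (jacobiPre q b).adjoint := fun h =>
    hJ (LinearPMap.isSelfAdjoint_closure (dense_domain_jacobiPre q b)
      (jacobiPre_le_adjoint q b) h)
  simp only [LinearPMap.IsFormalAdjoint, not_forall] at hns
  obtain ⟨x, y, hxy⟩ := hns
  have hx := (mem_graph_adjoint_jacobiPre q b _).1 (LinearPMap.mem_graph _ x)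
  have hy := (mem_graph_adjoint_jacobiPre q b _).1 (LinearPMap.mem_graph _ y)
  set Mx := (jacobiPre q b).adjoint x
  set My := (jacobiPre q b).adjoint y
  have ex : jacobiExpr q b (x : L2Seq) = Mx := funext fun k => (hx k).symm
  have ey : jacobiExpr q b (y : L2Seq) = My := funext fun k => (hy k).symm
  have ex' : jacobiExpr q b (fun k => conj ((x : L2Seq) k)) = ⇑(star Mx) := by
    funext k
    rw [jacobiExpr_conj, ex]
    rfl
  -- The Wronskian is bilinear and the inner product sesquilinear, hence the conjugate on x. The
  -- limit is the symmetry defect of the adjoint at x, y.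
  refine ⟨fun k => conj ((x : L2Seq) k), (y : L2Seq), lp.memℓp (star (x : L2Seq)), lp.memℓp _,
    ex' ▸ lp.memℓp (star Mx), ey ▸ lp.memℓp My, ⟪(x : L2Seq), My⟫_ℂ - ⟪Mx, (y : L2Seq)⟫_ℂ,
    sub_ne_zero.2 (Ne.symm hxy), ?_⟩
  have hs := ((lp.hasSum_inner (𝕜 := ℂ) (x : L2Seq) My).sub
    (lp.hasSum_inner (𝕜 := ℂ) Mx (y : L2Seq))).tendsto_sum_nat
  refine ((Filter.tendsto_add_atTop_iff_nat 1).2 hs).congr fun n => ?_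
  rw [← sum_jacobiExpr_eq_wronskian q]
  refine Finset.sum_congr rfl fun k _ => ?_
  rw [ex', ey, RCLike.inner_apply, RCLike.inner_apply, lp.star_apply, mul_comm,
    mul_comm ((y : L2Seq) k)]
  rfl

/-! ### Lower bounds by variation of constants -/

theorem norm_sum_mul_le (f g : L2Seq) (n : ℕ) :
    ‖∑ k ∈ Finset.range n, f k * g k‖ ≤ ‖f‖ * ‖g‖ := by
  have hpq : (2 : ENNReal).toReal.HolderConjugate (2 : ENNReal).toReal := by
    rw [ENNReal.toReal_ofNat]
    exact Real.HolderConjugate.two_two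
  refine (norm_sum_le _ _).trans ?_
  simp only [norm_mul]
  exact ((lp.summable_mul hpq f g).sum_le_tsum _ fun k _ => by positivity).trans
    (lp.tsum_mul_le_mul_norm' hpq f g)

/-- If all the solutions are square summable, the Jacobi operator is bounded below. -/
theorem jacobiPre_bounded_below {q b : ℕ → ℝ} {z : ℂ} {π θ : L2Seq}
    (hπ : IsJacobiSolution q b z 0 π) (hθ : IsJacobiSolution q b z 1 θ) (hπ0 : π 0 = 1)
    (a : (jacobiPre q b).domain) :
    ‖(a : L2Seq)‖ ≤ 3 * (‖π‖ * ‖θ‖) * ‖jacobiPre q b a - z • (a : L2Seq)‖ := by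
  set f : L2Seq := jacobiPre q b a - z • (a : L2Seq) with hf
  have hfk : ∀ k, jacobiExpr q b (a : L2Seq) k = f k + z * (a : L2Seq) k := fun k =>
    (sub_add_cancel (jacobiExpr q b (a : L2Seq) k) (z * (a : L2Seq) k)).symm
  have hWf : ∀ {c : ℂ} {u : L2Seq}, IsJacobiSolution q b z c u → ∀ n,
      wronskian b (a : L2Seq) u n
        = c * (a : L2Seq) 0 - ∑ k ∈ Finset.range (n + 1), f k * u k := by
    intro c u hu n
    have h1 := hu.wronskian_eq (a : L2Seq) n
    have h2 : wronskian b (a : L2Seq) u n = - wronskian b u (a : L2Seq) n := by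
      simp only [wronskian]; ring
    rw [h2, h1, neg_sub]
    congr 1
    refine Finset.sum_congr rfl fun k _ => ?_
    rw [hfk, add_sub_cancel_right, mul_comm]
  have hW1 : ∀ n, wronskian b π θ n = 1 := by
    intro n
    have h2 : wronskian b π θ n = - wronskian b θ π n := by simp only [wronskian]; ring
    rw [h2, hθ.wronskian_eq, Finset.sum_eq_zero, hπ0]
    · simp
    · intro k _
      simp [hπ k]
  -- Beyond the support of a its Wronskian with θ vanishes, which expresses a₀ as the sum of the f_k
  -- θ_k.
  have ha0 : ‖(a : L2Seq) 0‖ ≤ ‖f‖ * ‖θ‖ := by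
    obtain ⟨N, hN⟩ := exists_forall_ge_eq_zero a.2
    have h1 := hWf hθ N
    rw [one_mul] at h1
    simp only [wronskian, hN N le_rfl, hN (N + 1) (by omega), zero_mul, sub_zero, mul_zero] at h1
    rw [← sub_eq_zero.1 h1.symm |>.symm]
    exact norm_sum_mul_le f θ _
  -- The factor 2 arises because the Wronskian of a with θ contains both a₀ and a partial sum; the
  -- one with π has only a partial sum.
  have hpt : ∀ n, ‖(a : L2Seq) n‖ ≤
      ‖π n‖ * (2 * (‖f‖ * ‖θ‖)) + ‖θ n‖ * (‖f‖ * ‖π‖) := by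
    intro n
    cases n with
    | zero =>
      rw [hπ0, norm_one, one_mul]
      have : 0 ≤ ‖θ 0‖ * (‖f‖ * ‖π‖) := by positivity
      have : 0 ≤ ‖f‖ * ‖θ‖ := by positivity
      linarith
    | succ n =>
      have h1 := mul_wronskian_eq b (a : L2Seq) π θ n
      rw [hW1, mul_one] at h1
      rw [h1]
      refine (norm_sub_le _ _).trans ?_
      rw [norm_mul, norm_mul]
      refine add_le_add (mul_le_mul_of_nonneg_left ?_ (norm_nonneg _))
        (mul_le_mul_of_nonneg_left ?_ (norm_nonneg _))
      · rw [hWf hθ, one_mul, two_mul]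
        exact (norm_sub_le _ _).trans (add_le_add ha0 (norm_sum_mul_le f θ _))
      · rw [hWf hπ, zero_mul, zero_sub, norm_neg]
        exact norm_sum_mul_le f π _
  have hnorm := lp.norm_mono (p := 2) (by norm_num) (x := (a : L2Seq))
    (y := (2 * (‖f‖ * ‖θ‖)) • lp.toNorm π + (‖f‖ * ‖π‖) • lp.toNorm θ) (fun n => by
      refine (hpt n).trans ((le_abs_self _).trans_eq ?_)
      rw [← Real.norm_eq_abs]
      congr 1
      change _ = (2 * (‖f‖ * ‖θ‖)) * ‖π n‖ + (‖f‖ * ‖π‖) * ‖θ n‖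
      ring)
  refine hnorm.trans ((norm_add_le _ _).trans_eq ?_)
  rw [norm_smul, norm_smul, lp.norm_toNorm, lp.norm_toNorm, Real.norm_of_nonneg (by positivity),
    Real.norm_of_nonneg (by positivity)]
  ring

/-- The limit circle case: all the solutions are square summable, for every spectral parameter. -/
theorem IsJacobiSolution.memℓp {q b : ℕ → ℝ} (hJ : ¬ IsSelfAdjoint (jacobiOperator q b))
    {z c : ℂ} {u : ℕ → ℂ} (hu : IsJacobiSolution q b z c u) : Memℓp u 2 := by
  obtain ⟨φ, ψ, hφ, hψ, hφ', hψ', L, hL, hW⟩ := exists_tendsto_wronskian hJ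
  obtain ⟨N, h, hh, -, H⟩ := exists_dominating_sequence hφ hψ hφ' hψ' hL hW
  obtain ⟨C, -, hC⟩ := H ‖z‖ (norm_nonneg z)
  refine memℓp_of_eventually_le (N := N)
    (hh.const_mul (C * (‖c‖ + ∑ k ∈ Finset.range (N + 1), ‖u k‖))) fun n hn => ?_
  rw [mul_comm]
  exact hC z c u le_rfl hu n hn

/-- The square summable sequence `π(z)` of the polynomials of the first kind. -/
noncomputable def firstKindVector {q b : ℕ → ℝ} (hb : ∀ k, 0 < b k)
    (hJ : ¬ IsSelfAdjoint (jacobiOperator q b)) (z : ℂ) : L2Seq :=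
  ⟨fun k => Polynomial.aeval z (firstKindPoly q b k),
    (isJacobiSolution_firstKindPoly hb z).memℓp hJ⟩

/-! ### Regularity, deficiency indices and the entire gauge -/

section LimitCircle

variable {q b : ℕ → ℝ} (hb : ∀ k, 0 < b k) (hJ : ¬ IsSelfAdjoint (jacobiOperator q b))

theorem firstKindVector_apply (z : ℂ) (k : ℕ) :
    firstKindVector hb hJ z k = Polynomial.aeval z (firstKindPoly q b k) :=
  rfl

theorem isJacobiSolution_firstKindVector (z : ℂ) :
    IsJacobiSolution q b z 0 (firstKindVector hb hJ z) :=
  isJacobiSolution_firstKindPoly hb z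

theorem firstKindVector_zero (z : ℂ) : firstKindVector hb hJ z 0 = 1 := by
  simp [firstKindVector_apply, firstKindPoly]

theorem firstKindVector_ne_zero (z : ℂ) : firstKindVector hb hJ z ≠ 0 := fun h => by
  have := firstKindVector_zero hb hJ z
  rw [h] at this
  exact zero_ne_one this

theorem inner_firstKindVector_canonicalVector (z : ℂ) :
    ⟪firstKindVector hb hJ z, canonicalVector 0⟫_ℂ = 1 := by
  rw [canonicalVector, lp.inner_single_right, firstKindVector_zero]
  simp

theorem kernelSub_adjoint_jacobiOperator (z : ℂ) :
    kernelSub (jacobiOperator q b).adjoint z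
      = Submodule.span ℂ {firstKindVector hb hJ z} := by
  ext φ
  rw [Submodule.mem_span_singleton]
  constructor
  · intro hφ
    have h := mem_kernelSub_adjoint_jacobiOperator.1 hφ
    refine ⟨φ 0, ?_⟩
    ext n
    exact (h.eq_mul_firstKindPoly hb n).symm
  · rintro ⟨c, rfl⟩
    exact Submodule.smul_mem _ _
      (mem_kernelSub_adjoint_jacobiOperator.2 (isJacobiSolution_firstKindVector hb hJ z))

include hb hJ in
theorem rank_kernelSub_adjoint_jacobiOperator (z : ℂ) :
    Module.rank ℂ (kernelSub (jacobiOperator q b).adjoint z) = 1 := by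
  rw [kernelSub_adjoint_jacobiOperator hb hJ, ← Module.finrank_eq_rank,
    finrank_span_singleton (firstKindVector_ne_zero hb hJ z), Nat.cast_one]

include hb hJ in
theorem isRegularOperator_jacobiOperator : IsRegularOperator (jacobiOperator q b) where
  isClosed := (isClosable_jacobiPre q b).closure_isClosed
  bounded_below z := by
    have hθ := isJacobiSolution_secondKind (q := q) hb z
    set π := firstKindVector hb hJ z
    set θ : L2Seq := ⟨secondKind q b z, hθ.memℓp hJ⟩
    -- Adding 1 makes the constant invertible without checking that π and θ are nonzero.
    have hpos : 0 < 3 * (‖π‖ * ‖θ‖) + 1 := by positivity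
    refine ⟨(3 * (‖π‖ * ‖θ‖) + 1)⁻¹, inv_pos.2 hpos,
      (isClosable_jacobiPre q b).bounded_below_closure fun a => ?_⟩
    rw [inv_mul_le_iff₀ hpos]
    refine (jacobiPre_bounded_below (isJacobiSolution_firstKindVector hb hJ z) (θ := θ) hθ
      (firstKindVector_zero hb hJ z) a).trans ?_
    exact mul_le_mul_of_nonneg_right (le_add_of_nonneg_right zero_le_one) (norm_nonneg _)

theorem isSymmetricOperator_jacobiOperator (q b : ℕ → ℝ) :
    IsSymmetricOperator (jacobiOperator q b) :=
  LinearPMap.isSymmetricOperator_closure (dense_domain_jacobiPre q b) (jacobiPre_le_adjoint q b)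

include hb hJ in
theorem isEntireGauge_canonicalVector :
    IsEntireGauge (jacobiOperator q b) (canonicalVector 0) := by
  have h : exceptionalSet (jacobiOperator q b) (canonicalVector 0) = ∅ := by
    refine Set.eq_empty_of_forall_notMem fun z hz => hz ?_
    refine (isRegularOperator_jacobiOperator hb hJ).isCompl_span
      (isSymmetricOperator_jacobiOperator q b).dense_domain
      (kernelSub_adjoint_jacobiOperator hb hJ (conj z)) ?_
    rw [inner_firstKindVector_canonicalVector]
    exact one_ne_zero
  refine ⟨?_, h⟩
  rw [IsGauge, h]
  exact Set.countable_empty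

include hb hJ in
theorem isEntireOperator_jacobiOperator : IsEntireOperator (jacobiOperator q b) where
  regular := isRegularOperator_jacobiOperator hb hJ
  symmetric := isSymmetricOperator_jacobiOperator q b
  deficiency_pos := rank_kernelSub_adjoint_jacobiOperator hb hJ _
  deficiency_neg := rank_kernelSub_adjoint_jacobiOperator hb hJ _
  exists_gauge := ⟨_, isEntireGauge_canonicalVector hb hJ⟩

/-! ### Analyticity and reality of π(z) -/

/-- On a disc, the components of `π(z)` are dominated by a fixed square summable sequence. -/
theorem exists_firstKindVector_dominated (R : ℝ) (hR : 0 ≤ R) :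
    ∃ (N : ℕ) (h : lp (fun _ : ℕ => ℝ) 2), ∀ z, ‖z‖ ≤ R → ∀ n ≥ N,
      ‖firstKindVector hb hJ z n‖ ≤ h n := by
  obtain ⟨φ, ψ, hφ, hψ, hφ', hψ', L, hL, hW⟩ := exists_tendsto_wronskian hJ
  obtain ⟨N, h, hh, h0, H⟩ := exists_dominating_sequence hφ hψ hφ' hψ' hL hW
  obtain ⟨C, hC0, hC⟩ := H R hR
  have hcont : Continuous fun z : ℂ =>
      ∑ k ∈ Finset.range (N + 1), ‖Polynomial.aeval z (firstKindPoly q b k)‖ :=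
    continuous_finsetSum _ fun k _ => (Polynomial.continuous_aeval _).norm
  -- The finitely many initial entries in the dominating bound are polynomials in z, hence bounded
  -- on the disc.
  obtain ⟨S, hS⟩ := (isCompact_closedBall (0 : ℂ) R).exists_bound_of_continuousOn
    hcont.continuousOn
  refine ⟨N + 1, ⟨_, hh.const_mul (C * S)⟩, fun z hz n hn => ?_⟩
  obtain ⟨m, rfl⟩ : ∃ m, n = m + 1 := ⟨n - 1, by omega⟩
  have h1 := hC z 0 _ hz (isJacobiSolution_firstKindVector hb hJ z) m (by omega)
  rw [norm_zero, zero_add] at h1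
  have h2 := (le_abs_self _).trans (hS z (mem_closedBall_zero_iff.2 hz))
  refine h1.trans ?_
  change _ ≤ C * S * h (m + 1)
  rw [mul_comm (C * S)]
  exact mul_le_mul_of_nonneg_left (mul_le_mul_of_nonneg_left h2 hC0) (h0 _)

theorem sum_single_apply {E : Type*} [NormedAddCommGroup E] (f : ℕ → E) (s : Finset ℕ)
    (n : ℕ) :
    (∑ k ∈ s, lp.single (E := fun _ : ℕ => E) 2 k (f k) : lp (fun _ : ℕ => E) 2) n
      = if n ∈ s then f n else 0 := by
  rw [lp.coeFn_sum, Finset.sum_apply]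
  simp [Pi.single_apply]

theorem differentiable_firstKindVector : Differentiable ℂ (firstKindVector hb hJ) := by
  set F : ℕ → ℂ → L2Seq := fun n z =>
    ∑ k ∈ Finset.range n, lp.single 2 k (firstKindVector hb hJ z k) with hF
  have hFd : ∀ n, Differentiable ℂ (F n) := by
    intro n
    refine Differentiable.fun_sum fun k _ => ?_
    exact (lp.singleContinuousLinearMap ℂ (fun _ : ℕ => ℂ) 2 k).differentiable.comp
      (Polynomial.differentiable_aeval (firstKindPoly q b k))
  intro w
  set R := ‖w‖ + 1
  -- Each tail of π(z) is dominated entrywise by the same tail of h, whose norm tends to zero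
  -- independently of z.
  have hunif : TendstoUniformlyOn F (firstKindVector hb hJ) Filter.atTop (Metric.ball 0 R) := by
    obtain ⟨N, h, hh⟩ := exists_firstKindVector_dominated hb hJ R (by positivity)
    have hlim := (lp.hasSum_single (by norm_num) h).tendsto_sum_nat
    rw [Metric.tendstoUniformlyOn_iff]
    intro ε hε
    filter_upwards [Metric.tendsto_nhds.1 hlim ε hε, Filter.eventually_ge_atTop N] with n hn hnN z hz
    refine lt_of_le_of_lt ?_ hn
    rw [dist_comm _ h, dist_eq_norm, dist_eq_norm]
    refine lp.norm_mono (by norm_num) fun i => ?_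
    rw [lp.coeFn_sub, lp.coeFn_sub, Pi.sub_apply, Pi.sub_apply, sum_single_apply, sum_single_apply]
    split_ifs with hi
    · simp
    · rw [sub_zero, sub_zero]
      exact (hh z (mem_ball_zero_iff.1 hz).le i
        (hnN.trans (by simpa using hi))).trans (le_abs_self _)
  have hw : w ∈ Metric.ball (0 : ℂ) R := by simp [R]
  exact (hunif.tendstoLocallyUniformlyOn.differentiableOn
    (Filter.Eventually.of_forall fun n => (hFd n).differentiableOn) Metric.isOpen_ball
    ).differentiableAt (Metric.isOpen_ball.mem_nhds hw)

theorem star_firstKindVector (z : ℂ) :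
    star (firstKindVector hb hJ z) = firstKindVector hb hJ (conj z) := by
  ext k
  exact conj_aeval_firstKindPoly q b z k

theorem isKreinFunction_firstKindVector :
    IsKreinFunction (jacobiOperator q b) (fun φ : L2Seq => star φ) (firstKindVector hb hJ) where
  entire := differentiable_firstKindVector hb hJ
  zero_free := firstKindVector_ne_zero hb hJ
  mem_kernel z :=
    mem_kernelSub_adjoint_jacobiOperator.2 (isJacobiSolution_firstKindVector hb hJ z)
  real := star_firstKindVector hb hJ

end LimitCircle

theorem proposition5p6 (q b : ℕ → ℝ) (hb : ∀ k, 0 < b k)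
    (hJ : ¬ IsSelfAdjoint (jacobiOperator q b)) :
    IsEntireOperator (jacobiOperator q b) ∧
    IsEntireGauge (jacobiOperator q b) (canonicalVector 0) ∧
    IsConjugation (fun φ : L2Seq => star φ) ∧
    CommutesWith (fun φ : L2Seq => star φ) (jacobiOperator q b) ∧
    ∃ ξ : ℂ → L2Seq,
      (∀ z k, ξ z k = Polynomial.aeval z (firstKindPoly q b k)) ∧
      IsKreinFunction (jacobiOperator q b) (fun φ : L2Seq => star φ) ξ ∧
      ∀ z, ⟪ξ (conj z), canonicalVector 0⟫_ℂ = 1 :=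
  ⟨isEntireOperator_jacobiOperator hb hJ, isEntireGauge_canonicalVector hb hJ,
    isConjugation_star, commutesWith_star_jacobiOperator q b, firstKindVector hb hJ,
    firstKindVector_apply hb hJ, isKreinFunction_firstKindVector hb hJ,
    fun z => inner_firstKindVector_canonicalVector hb hJ (conj z)⟩
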